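/- For a sequence $s = (s(i))_{i\ge 0}$ of distinct integers, the discriminator of $s$ is the sequence $(D_s(n))_{n\ge 0}$ in which, for $n\ge 1$, $D_s(n)$ is the least positive integer $m$ such that $s(0), s(1), \ldots, s(n-1)$ are pairwise incongruent modulo $m$, and $D_s(0)=0$. For an integer $k\ge 2$, a sequence $(a(n))_{n\ge 0}$ of integers is called $k$-regular if there is a finitely generated $\mathbb{Z}$-module of integer sequences that contains all the subsequences $(a(k^e n+i))_{n\ge 0}$ with $e\ge 0$ and $0\le i<k^e$. Theorem. Let $D_{\rm sq}$ be the discriminator of the sequence $((i+1)^2)_{i\ge 0} = 1, 4, 9, 16, \ldots$ of positive perfect squares. Then, for every integer $k\ge 2$, the sequence $(D_{\rm sq}(n))_{n\ge 0}$ is not $k$-regular. -/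

import Mathlib

/-- `m` discriminates `s 0, …, s (n - 1)`: these `n` integers are pairwise incongruent
modulo `m`. -/
def Discriminates (s : ℕ → ℤ) (n m : ℕ) : Prop :=
  ∀ i < n, ∀ j < n, i ≠ j → ¬ s i ≡ s j [ZMOD (m : ℤ)]

/-- The discriminator of `s`: its value at `n ≥ 1` is the least positive integer that
discriminates `s 0, …, s (n - 1)` (one exists whenever the terms of `s` are distinct),
and its value at `0` is `0`. -/
noncomputable def discriminator (s : ℕ → ℤ) (n : ℕ) : ℕ :=
  if n = 0 then 0 else sInf {m : ℕ | 0 < m ∧ Discriminates s n m}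

/-- An integer sequence `s` is `k`-regular (for `k ≥ 2`) if all the subsequences
`(s (k ^ e * n + i))_{n ≥ 0}` with `e ≥ 0` and `0 ≤ i < k ^ e` lie in one finitely generated
`ℤ`-module of integer sequences. -/
def IsKRegular (k : ℕ) (s : ℕ → ℤ) : Prop :=
  ∃ M : Submodule ℤ (ℕ → ℤ), M.FG ∧
    ∀ e i : ℕ, i < k ^ e → (fun n : ℕ => s (k ^ e * n + i)) ∈ M

/-- The sequence `1, 4, 9, 16, …` of positive perfect squares, indexed from `0`. -/
def squares (n : ℕ) : ℤ := ((n : ℤ) + 1) ^ 2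

/-! The jumps of the discriminator D are sparse but would be forced into too many residue classes.
For n ≥ 40, D(n) lies in [2n, 4n - 2] and is a prime or twice a prime, so a jump after n makes n or
2n + 1 prime. Conversely D jumps after each prime q ≥ 3. If D were regular, with K = k^e,
`exists_determining_segment` applied to differences of neighbouring subsequences, with Dirichlet's
theorem, would give jumps below KN in all classes prime to K but at most one, N being independent of
e. But φ(K) ≥ K/k for e ≥ 1, while π(2KN) = o(K). -/

/-- A finitely generated module of integer sequences has an initial segment of indices at which
the values determine the sequence. -/
theorem exists_determining_segment (M : Submodule ℤ (ℕ → ℤ)) (hM : M.FG) :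
    ∃ N : ℕ, ∀ g ∈ M, (∀ j < N, g j = 0) → g = 0 := by
  obtain ⟨S, hS⟩ := hM
  let φ : (ℕ → ℤ) →ₗ[ℤ] (ℕ → ℚ) :=
    { toFun := fun g n => (g n : ℚ)
      map_add' := fun f g => by ext n; simp
      map_smul' := fun c g => by ext n; simp }
  let V : Submodule ℚ (ℕ → ℚ) := Submodule.span ℚ (φ '' (S : Set (ℕ → ℤ)))
  have : FiniteDimensional ℚ V :=
    FiniteDimensional.span_of_finite ℚ (S.finite_toSet.image φ)
  have hV : ∀ g ∈ M, φ g ∈ V := by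
    intro g hg
    have h : M ≤ (V.restrictScalars ℤ).comap φ := by
      rw [← hS, Submodule.span_le]
      intro s hs
      exact Submodule.subset_span ⟨s, hs, rfl⟩
    exact h hg
  -- The subspaces vanishing on the first N indices decrease, so they stabilize in the
  -- finite-dimensional `V`.
  let K : ℕ →o (Submodule ℚ V)ᵒᵈ :=
    { toFun := fun N => OrderDual.toDual
        { carrier := {v | ∀ j < N, v.1 j = 0}
          add_mem' := fun {a b} ha hb j hj => by
            simp [ha j hj, hb j hj]
          zero_mem' := fun j _ => rfl
          smul_mem' := fun c a ha j hj => by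
            simp [ha j hj] }
      monotone' := fun a b hab => by
        intro v hv j hj
        exact hv j (hj.trans_le hab) }
  obtain ⟨N, hN⟩ := IsArtinian.monotone_stabilizes K
  refine ⟨N, fun g hg h0 => ?_⟩
  ext m
  have h1 : (⟨φ g, hV g hg⟩ : V) ∈ OrderDual.ofDual (K N) := by
    intro j hj
    change ((g j : ℤ) : ℚ) = 0
    rw [h0 j hj, Int.cast_zero]
  rw [hN (max N (m + 1)) (le_max_left _ _)] at h1
  have h2 : ((g m : ℤ) : ℚ) = 0 := h1 m (by omega)
  exact_mod_cast h2

theorem primeCounting_le_mul_eventually {ε : ℝ} (hε : 0 < ε) :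
    ∃ X : ℕ, ∀ x ≥ X, (Nat.primeCounting x : ℝ) ≤ ε * x := by
  have h1 := Chebyshev.eventually_primeCounting_le (ε := 1) one_pos
  have h2 := Real.tendsto_log_atTop.eventually_ge_atTop ((Real.log 4 + 1) / ε)
  have h3 := (h1.and (h2.and (Filter.eventually_ge_atTop (2 : ℝ))))
  obtain ⟨X, hX⟩ := Filter.eventually_atTop.1 (tendsto_natCast_atTop_atTop.eventually h3)
  refine ⟨X, fun x hx => ?_⟩
  obtain ⟨ha, hb, hc⟩ := hX x hx
  rw [Nat.floor_natCast] at ha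
  refine ha.trans ?_
  have hlog : 0 < Real.log x := Real.log_pos (by linarith)
  rw [div_le_iff₀ hlog]
  rw [div_le_iff₀ hε] at hb
  nlinarith

theorem discriminates_squares_iff {n m : ℕ} :
    Discriminates squares n m ↔
      ∀ a b : ℕ, 1 ≤ b → b < a → a ≤ n → ¬ m ∣ (a - b) * (a + b) := by
  have key : ∀ a b : ℕ, b < a → ((m : ℤ) ∣ (a : ℤ) ^ 2 - (b : ℤ) ^ 2 ↔ m ∣ (a - b) * (a + b)) := by
    intro a b hab
    rw [← Int.natCast_dvd_natCast]
    push_cast [hab.le]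
    rw [show (a : ℤ) ^ 2 - (b : ℤ) ^ 2 = (a - b) * (a + b) by ring]
  constructor
  · intro h a b hb hab ha hd
    refine h (b - 1) (by omega) (a - 1) (by omega) (by omega) ?_
    rw [Int.modEq_iff_dvd]
    simp only [squares]
    push_cast [hb, hb.trans hab.le]
    simpa using (key a b hab).2 hd
  · have main : (∀ a b : ℕ, 1 ≤ b → b < a → a ≤ n → ¬ m ∣ (a - b) * (a + b)) →
        ∀ i j : ℕ, i < j → j < n → ¬ squares i ≡ squares j [ZMOD (m : ℤ)] := by
      intro h i j hij hj hd
      rw [Int.modEq_iff_dvd] at hd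
      refine h (j + 1) (i + 1) (by omega) (by omega) (by omega) ((key _ _ (by omega)).1 ?_)
      simpa [squares] using hd
    intro h i hi j hj hij hd
    rcases lt_or_gt_of_ne hij with h' | h'
    · exact main h i j h' hj hd
    · exact main h j i h' hi hd.symm

/-- A prime `p > 2 n` discriminates the first `n` squares. -/
theorem discriminates_squares_prime {n p : ℕ} (hp : p.Prime) (h : 2 * n < p) :
    Discriminates squares n p := by
  rw [discriminates_squares_iff]
  intro a b hb hab ha hd
  rcases (Nat.Prime.dvd_mul hp).1 hd with h' | h'
  · have := Nat.le_of_dvd (by omega) h'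
    omega
  · have := Nat.le_of_dvd (by omega) h'
    omega

/-- Twice an odd prime `q ≥ n` discriminates the first `n` squares. -/
theorem discriminates_squares_two_mul_prime {n q : ℕ} (hq : q.Prime) (hq2 : q ≠ 2) (h : n ≤ q) :
    Discriminates squares n (2 * q) := by
  rw [discriminates_squares_iff]
  intro a b hb hab ha hd
  have hodd : q % 2 = 1 := hq.eq_two_or_odd.resolve_left hq2
  have h2 : 2 ∣ (a - b) * (a + b) := (Dvd.intro _ rfl).trans hd
  have hsum : 2 ∣ a + b := by
    rcases (Nat.Prime.dvd_mul Nat.prime_two).1 h2 with h' | h' <;> omega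
  rcases (Nat.Prime.dvd_mul hq).1 ((Dvd.intro_left _ rfl).trans hd) with h' | h'
  · have := Nat.le_of_dvd (by omega) h'
    omega
  · obtain ⟨c, hc⟩ := h'
    have hc2 : c < 2 := by
      by_contra hcon
      nlinarith
    interval_cases c <;> omega

/-- A modulus that discriminates the first `n ≥ 3` squares is at least `2 n`. -/
theorem two_mul_le_of_discriminates_squares {n m : ℕ} (hn : 3 ≤ n) (hm : 0 < m)
    (h : Discriminates squares n m) : 2 * n ≤ m := by
  rw [discriminates_squares_iff] at h
  by_contra hlt
  rcases lt_trichotomy m n with h' | h' | h'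
  · refine h (1 + m) 1 le_rfl (by omega) (by omega) ?_
    simp
  · refine h (n - 1) 1 le_rfl (by omega) (by omega) ?_
    rw [show n - 1 + 1 = m by omega]
    exact Dvd.intro_left _ rfl
  · refine h n (m - n) (by omega) (by omega) le_rfl ?_
    rw [show n + (m - n) = m by omega]
    exact Dvd.intro_left _ rfl

/-- A modulus below `4 n` that discriminates the first `n` squares, for large `n`, is prime or
twice a prime. -/
theorem prime_or_two_mul_prime_of_discriminates_squares {n m : ℕ} (hn : 40 ≤ n)
    (hm2 : 2 ≤ m) (hm : m + 2 ≤ 4 * n) (h : Discriminates squares n m) :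
    m.Prime ∨ ∃ q, q.Prime ∧ m = 2 * q := by
  have hbig := two_mul_le_of_discriminates_squares (by omega) (by omega) h
  rw [discriminates_squares_iff] at h
  by_contra! hcon
  obtain ⟨hnp, hn2⟩ := hcon
  have factor : ∀ c : ℕ, 2 ≤ c → c % 2 = 1 → ¬ c.Prime →
      ∃ a b, 3 ≤ a ∧ a ≤ b ∧ a % 2 = 1 ∧ b % 2 = 1 ∧ c = a * b := by
    intro c hc hodd hcp
    obtain ⟨a, ⟨b, hab⟩, ha1, hac⟩ := Nat.exists_dvd_of_not_prime2 hc hcp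
    have hao : a % 2 = 1 := by
      rcases Nat.mod_two_eq_zero_or_one a with h0 | h0
      · rw [hab, Nat.mul_mod, h0] at hodd; simp at hodd
      · exact h0
    have hbo : b % 2 = 1 := by
      rcases Nat.mod_two_eq_zero_or_one b with h0 | h0
      · rw [hab, Nat.mul_mod, h0] at hodd; simp at hodd
      · exact h0
    have hb1 : b ≠ 1 := by rintro rfl; omega
    rcases le_total a b with hle | hle
    · exact ⟨a, b, by omega, hle, hao, hbo, hab⟩
    · exact ⟨b, a, by omega, hle, hbo, hao, by rw [hab, mul_comm]⟩
  rcases Nat.mod_two_eq_zero_or_one m with hm0 | hm1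
  · obtain ⟨c, rfl⟩ : 2 ∣ m := by omega
    rcases Nat.mod_two_eq_zero_or_one c with hc0 | hc1
    · obtain ⟨d, rfl⟩ : 2 ∣ c := by omega
      -- Each factorization of m gives two squares with difference a multiple of m; here 4d = (d +
      -- 1)² - (d - 1)².
      refine h (d + 1) (d - 1) (by omega) (by omega) (by omega) ?_
      rw [show d + 1 - (d - 1) = 2 by omega, show d + 1 + (d - 1) = 2 * d by omega]
    · obtain ⟨a, b, ha, hab, hao, hbo, rfl⟩ := factor c (by omega) hc1 (fun hp => hn2 c hp rfl)
      rcases hab.eq_or_lt with rfl | hlt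
      · refine h (3 * a) a (by omega) (by omega) (by nlinarith) ?_
        rw [show 3 * a - a = 2 * a by omega]
        exact ⟨4, by ring⟩
      · refine h (a + b) (b - a) (by omega) (by omega) (by nlinarith) ?_
        rw [show a + b - (b - a) = 2 * a by omega, show a + b + (b - a) = 2 * b by omega]
        exact ⟨2, by ring⟩
  · obtain ⟨a, b, ha, hab, hao, hbo, rfl⟩ := factor m hm2 hm1 hnp
    rcases hab.eq_or_lt with rfl | hlt
    · refine h (2 * a) a (by omega) (by omega) (by nlinarith) ?_
      rw [show 2 * a - a = a by omega]
      exact ⟨3, by ring⟩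
    · obtain ⟨i, hi⟩ : 2 ∣ a + b := by omega
      refine h i (b - i) (by omega) (by omega) (by nlinarith) ?_
      rw [show i - (b - i) = a by omega, show i + (b - i) = b by omega]

theorem discriminator_le {s : ℕ → ℤ} {n m : ℕ} (hm : 0 < m) (h : Discriminates s n m) :
    discriminator s n ≤ m := by
  unfold discriminator
  split_ifs
  · exact Nat.zero_le _
  · exact Nat.sInf_le ⟨hm, h⟩

theorem discriminator_spec {s : ℕ → ℤ} {n m : ℕ} (hn : n ≠ 0) (hm : 0 < m)
    (h : Discriminates s n m) :
    0 < discriminator s n ∧ Discriminates s n (discriminator s n) := by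
  unfold discriminator
  rw [if_neg hn]
  exact Nat.sInf_mem (s := {m : ℕ | 0 < m ∧ Discriminates s n m}) ⟨m, hm, h⟩

theorem discriminator_le_succ {s : ℕ → ℤ} {n m : ℕ}
    (hm : 0 < m) (h : Discriminates s (n + 1) m) :
    discriminator s n ≤ discriminator s (n + 1) := by
  obtain ⟨h0, h1⟩ := discriminator_spec (Nat.succ_ne_zero n) hm h
  exact discriminator_le h0 fun i hi j hj => h1 i (by omega) j (by omega)

theorem exists_discriminates_squares {n : ℕ} (hn : 3 ≤ n) :
    ∃ m, 0 < m ∧ m + 2 ≤ 4 * n ∧ Discriminates squares n m := by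
  obtain ⟨p, hp, hnp, hp2⟩ := Nat.exists_prime_lt_and_le_two_mul n (by omega)
  have hne : p ≠ 2 * n := by
    rintro rfl
    exact Nat.not_prime_mul (by omega) (by omega) hp
  exact ⟨2 * p, by omega, by omega,
    discriminates_squares_two_mul_prime hp (by omega) hnp.le⟩

theorem two_mul_le_discriminator_squares {n : ℕ} (hn : 3 ≤ n) :
    2 * n ≤ discriminator squares n := by
  obtain ⟨m, hm, -, h⟩ := exists_discriminates_squares hn
  obtain ⟨h0, h1⟩ := discriminator_spec (by omega) hm h
  exact two_mul_le_of_discriminates_squares hn h0 h1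

/-- D(q) ≤ 2q < 2(q + 1) ≤ D(q + 1). -/
theorem discriminator_squares_ne_succ_of_prime {q : ℕ} (hq : q.Prime) (h : 3 ≤ q) :
    discriminator squares (q + 1) ≠ discriminator squares q := by
  have h1 := two_mul_le_discriminator_squares (n := q + 1) (by omega)
  have h2 := discriminator_le (by omega)
    (discriminates_squares_two_mul_prime hq (by omega) le_rfl)
  omega

/-- The discriminator of the squares jumps after `n` only if `n` or `2 n + 1` is prime. -/
theorem prime_of_discriminator_squares_ne_succ {n : ℕ} (hn : 40 ≤ n)
    (h : discriminator squares (n + 1) ≠ discriminator squares n) :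
    n.Prime ∨ (2 * n + 1).Prime := by
  obtain ⟨m, hm, hm4, hd⟩ := exists_discriminates_squares (n := n) (by omega)
  obtain ⟨h0, h1⟩ := discriminator_spec (by omega) hm hd
  have h2 := two_mul_le_discriminator_squares (n := n) (by omega)
  have h4 := discriminator_le hm hd
  obtain ⟨m', hm', -, hd'⟩ := exists_discriminates_squares (n := n + 1) (by omega)
  have hmono := discriminator_le_succ hm' hd'
  have hnot : ¬ Discriminates squares (n + 1) (discriminator squares n) := fun hcon =>
    h (le_antisymm (discriminator_le h0 hcon) hmono)
  rcases prime_or_two_mul_prime_of_discriminates_squares hn (by omega) (by omega) h1 with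
    hp | ⟨q, hq, hDq⟩
  · right
    have hodd := hp.eq_two_or_odd
    -- Being odd and in [2n, 2n + 2], D(n) must be 2n + 1.
    have : ¬ 2 * (n + 1) < discriminator squares n := fun hlt =>
      hnot (discriminates_squares_prime hp hlt)
    rwa [show 2 * n + 1 = discriminator squares n by omega]
  · left
    rw [hDq] at hnot
    have : ¬ n + 1 ≤ q := fun hle =>
      hnot (discriminates_squares_two_mul_prime hq (by omega) hle)
    rwa [show n = q by omega]

/-- The number of `m < x` with `m < c`, `m` prime or `2 m + 1` prime is at most
`c + 2 π(2 x)`. -/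
theorem card_filter_prime_or_le (c x : ℕ) :
    ((Finset.range x).filter fun m => m < c ∨ m.Prime ∨ (2 * m + 1).Prime).card ≤
      c + 2 * Nat.primeCounting (2 * x) := by
  rw [Finset.filter_or, Finset.filter_or]
  have h1 : ((Finset.range x).filter fun m => m < c).card ≤ c := by
    calc _ ≤ (Finset.range c).card := Finset.card_le_card fun m hm => by
          simp only [Finset.mem_filter, Finset.mem_range] at hm ⊢; exact hm.2
      _ = c := Finset.card_range c
  have h2 : ((Finset.range x).filter Nat.Prime).card ≤ Nat.primeCounting (2 * x) := by
    rw [← Nat.primesLE_card_eq_primeCounting]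
    refine Finset.card_le_card fun m hm => ?_
    simp only [Finset.mem_filter, Finset.mem_range] at hm
    rw [Nat.mem_primesLE]
    exact ⟨by omega, hm.2⟩
  have h3 : ((Finset.range x).filter fun m => (2 * m + 1).Prime).card ≤
      Nat.primeCounting (2 * x) := by
    rw [← Nat.primesLE_card_eq_primeCounting]
    refine Finset.card_le_card_of_injOn (fun m => 2 * m + 1) (fun m hm => ?_)
      (fun a _ b _ hab => by simpa using hab)
    simp only [Finset.coe_filter, Finset.mem_range, Set.mem_ofPred_eq] at hm
    rw [Finset.mem_coe, Nat.mem_primesLE]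
    dsimp only
    exact ⟨by omega, hm.2⟩
  have h4 := Finset.card_union_le ((Finset.range x).filter fun m => m < c)
    ((Finset.range x).filter Nat.Prime ∪ (Finset.range x).filter fun m => (2 * m + 1).Prime)
  have h5 := Finset.card_union_le ((Finset.range x).filter Nat.Prime)
    ((Finset.range x).filter fun m => (2 * m + 1).Prime)
  omega

/-- If the discriminator of the squares is `k`-regular, its jumps already meet every class
modulo `k ^ e` that is prime to `k`, save the last one, in a segment of length `O(k ^ e)`. -/
theorem totient_le_of_isKRegular {k : ℕ} (hk : 2 ≤ k)
    (h : IsKRegular k (fun n : ℕ => (discriminator squares n : ℤ))) :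
    ∃ N : ℕ, ∀ e : ℕ, Nat.totient (k ^ e) ≤ 41 + 2 * Nat.primeCounting (2 * (k ^ e * N)) := by
  obtain ⟨M, hM, hmem⟩ := h
  obtain ⟨N, hN⟩ := exists_determining_segment M hM
  refine ⟨N, fun e => ?_⟩
  have hK : 0 < k ^ e := by positivity
  generalize hKe : k ^ e = K at hK
  -- The class K - 1 is left out because i + 1 must also be a residue below K; this turns 40 into
  -- 41.
  have jump : ∀ i, i + 1 < K → K.Coprime i → ∃ j < N,
      discriminator squares (K * j + i + 1) ≠ discriminator squares (K * j + i) := by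
    intro i hi hcop
    by_contra! hcon
    have hg := M.sub_mem (hmem e (i + 1) (by omega)) (hmem e i (by omega))
    have hzero := hN _ hg fun j hj => by
      have := hcon j hj
      simp only [Pi.sub_apply, hKe, ← add_assoc, this, sub_self]
    obtain ⟨q, hq, hqp, hqi⟩ :=
      Nat.forall_exists_prime_gt_and_modEq (K + 3) hK.ne' hcop.symm
    have hmod : q % K = i := by
      rw [hqi, Nat.mod_eq_of_lt (by omega)]
    have hdecomp : K * (q / K) + i = q := by rw [← hmod]; exact Nat.div_add_mod q K
    have h1 := congrFun hzero (q / K)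
    simp only [Pi.sub_apply, hKe, ← add_assoc, hdecomp, Pi.zero_apply, sub_eq_zero,
      Nat.cast_inj] at h1
    exact discriminator_squares_ne_succ_of_prime hqp (by omega) h1
  choose! J hJN hJ using jump
  have hcard : (((Finset.range K).filter K.Coprime).erase (K - 1)).card ≤
      40 + 2 * Nat.primeCounting (2 * (K * N)) := by
    refine le_trans (Finset.card_le_card_of_injOn (fun i => K * J i + i) ?_ ?_)
      (card_filter_prime_or_le 40 (K * N))
    · intro i hi
      simp only [Finset.coe_erase, Finset.coe_filter, Finset.mem_range, Set.mem_sdiff,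
        Set.mem_ofPred_eq, Set.mem_singleton_iff] at hi
      obtain ⟨⟨hiK, hcop⟩, hne⟩ := hi
      have hj := hJN i (by omega) hcop
      have hd := hJ i (by omega) hcop
      simp only [Finset.coe_filter, Finset.mem_range, Set.mem_ofPred_eq]
      refine ⟨by nlinarith, ?_⟩
      by_cases hs : K * J i + i < 40
      · exact Or.inl hs
      · exact Or.inr (prime_of_discriminator_squares_ne_succ (by omega) hd)
    · intro a ha b hb hab
      simp only [Finset.coe_erase, Finset.coe_filter, Finset.mem_range, Set.mem_sdiff,
        Set.mem_ofPred_eq, Set.mem_singleton_iff] at ha hb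
      have := congrArg (· % K) hab
      simpa [Nat.mod_eq_of_lt ha.1.1, Nat.mod_eq_of_lt hb.1.1] using this
  have hpred := Finset.pred_card_le_card_erase (s := (Finset.range K).filter K.Coprime)
    (a := K - 1)
  have htot : Nat.totient K = ((Finset.range K).filter K.Coprime).card := rfl
  omega

/-- In φ(n) ∏ p = n ∏ (p - 1), the left product is at most k and the right one at least 1. -/
theorem pow_le_totient_pow_succ {k : ℕ} (hk : 0 < k) (e : ℕ) :
    k ^ e ≤ Nat.totient (k ^ (e + 1)) := by
  have h := Nat.totient_mul_prod_primeFactors (k ^ (e + 1))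
  rw [Nat.primeFactors_pow k (Nat.succ_ne_zero e)] at h
  have hrad : ∏ p ∈ k.primeFactors, p ≤ k := Nat.le_of_dvd hk (Nat.prod_primeFactors_dvd k)
  have hpos : 0 < ∏ p ∈ k.primeFactors, (p - 1) :=
    Finset.prod_pos fun p hp => Nat.sub_pos_of_lt (Nat.prime_of_mem_primeFactors hp).one_lt
  refine Nat.le_of_mul_le_mul_right ?_ hk
  calc k ^ e * k = k ^ (e + 1) := (pow_succ k e).symm
    _ ≤ k ^ (e + 1) * ∏ p ∈ k.primeFactors, (p - 1) := Nat.le_mul_of_pos_right _ hpos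
    _ = Nat.totient (k ^ (e + 1)) * ∏ p ∈ k.primeFactors, p := h.symm
    _ ≤ Nat.totient (k ^ (e + 1)) * k := Nat.mul_le_mul_left _ hrad

theorem theorem9 (k : ℕ) (hk : 2 ≤ k) :
    ¬ IsKRegular k (fun n : ℕ => (discriminator squares n : ℤ)) := by
  intro h
  obtain ⟨N, hN⟩ := totient_le_of_isKRegular hk h
  have hk0 : (0 : ℝ) < k := by exact_mod_cast (by omega : 0 < k)
  -- This ε makes twice the prime count at most k^e / 2, whence k^e ≤ 82.
  have hε : (0 : ℝ) < 1 / (8 * k * (N + 1)) := by positivity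
  obtain ⟨X, hX⟩ := primeCounting_le_mul_eventually hε
  obtain ⟨e, he⟩ : ∃ e : ℕ, X + 83 < k ^ e := ⟨X + 83, Nat.lt_pow_self (by omega)⟩
  have h1 := hN (e + 1)
  have h2 := pow_le_totient_pow_succ (by omega : 0 < k) e
  have hlarge : X ≤ 2 * (k ^ (e + 1) * (N + 1)) := by
    have : k ^ e ≤ k ^ (e + 1) := Nat.pow_le_pow_right (by omega) (by omega)
    nlinarith
  have h3 := hX _ hlarge
  have h4 : Nat.primeCounting (2 * (k ^ (e + 1) * N)) ≤
      Nat.primeCounting (2 * (k ^ (e + 1) * (N + 1))) :=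
    Nat.monotone_primeCounting (by gcongr; omega)
  have h5 : (1 / (8 * k * (N + 1)) : ℝ) * ((2 * (k ^ (e + 1) * (N + 1)) : ℕ) : ℝ) =
      (k : ℝ) ^ e / 4 := by
    push_cast
    field_simp
    ring
  rw [h5] at h3
  have h6 : (k : ℝ) ^ e ≤ 41 + 2 * Nat.primeCounting (2 * (k ^ (e + 1) * (N + 1))) := by
    have : k ^ e ≤ 41 + 2 * Nat.primeCounting (2 * (k ^ (e + 1) * (N + 1))) := by omega
    exact_mod_cast this
  have h7 : (83 : ℝ) < (k : ℝ) ^ e := by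
    have : 83 < k ^ e := by omega
    exact_mod_cast this
  linarith
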